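/- A single server serves two service points, each with an infinite queue of customers. Each customer needs a preparation phase (which starts as soon as the previous customer at the same service point has been served) before being served. Service times are i.i.d. with the law of a random variable $A\ge 0$, preparation times are i.i.d. with the law of a random variable $B>0$ (almost surely), and the two sequences are independent; otherwise the two laws are arbitrary, except that $B-A$ is not almost surely equal to a positive constant. In the alternating system the server must alternate between the service points, so that its waiting times satisfy $W_{n+1}=\max\{0,B_{n+1}-A_n-W_n\}$. Let $W^{\mathrm A}$ have any stationary law of this recursion, i.e. $W^{\mathrm A}\stackrel{d}{=}\max\{0,B-A-W^{\mathrm A}\}$ with $A,B,W^{\mathrm A}$ independent on the right-hand side. In the non-alternating system the server takes the first customer that is ready. If $R_n$ is the remaining preparation time at the other service point just after a service completion, then the server waits $W_n=\min\{B_{n+1},R_n\}$ and $R_{n+1}=\max\{0,\ \max\{B_{n+1},R_n\}-\min\{B_{n+1},R_n\}-A_n\}$. Let $R$ have any stationary law of this recursion, i.e. $R\stackrel{d}{=}\max\{0,|B-R|-A\}$ with $A,B,R$ independent on the right-hand side, and let $W^{\mathrm{NA}}=\min\{B,R\}$ with $B$ and $R$ independent. Then $$\mathbb P[W^{\mathrm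 A}=0]\ \ge\ \mathbb P[W^{\mathrm{NA}}=0].$$ -/

import Mathlib

open MeasureTheory

noncomputable section

/-- One step of the waiting time of the server in the alternating system,
`W_{n+1} = max {0, B_{n+1} - A_n - W_n}`. -/
def altStep (w a b : ℝ) : ℝ := max 0 (b - a - w)

/-- Waiting time of the server in the non-alternating system when, just after a service completion,
one service point starts a preparation of length `b` and the other one has remaining preparation
time `r`: the server takes the first customer that is ready. -/
def nonAltWait (r b : ℝ) : ℝ := min b r

/-- Remaining preparation time that the server of the non-alternating system finds at the other
service point just after the next service completion: the customer that is ready first (at time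
`min b r`) is served during a time `a`, and meanwhile the other customer (ready at time `max b r`)
goes on with the preparation. -/
def nonAltStep (r a b : ℝ) : ℝ := max 0 (max b r - (nonAltWait r b + a))

/-- `π` is a stationary law of the waiting time in the alternating system with service time law `μA`
and preparation time law `μB`: if `W ∼ π`, `A ∼ μA`, `B ∼ μB` are independent, then
`max {0, B - A - W} ∼ π`. -/
structure IsStationaryAlt (μA μB π : Measure ℝ) : Prop where
  isProbabilityMeasure : IsProbabilityMeasure π
  invariant : (π.prod (μA.prod μB)).map (fun p => altStep p.1 p.2.1 p.2.2) = π

/-- `ρ` is a stationary law of the remaining preparation time just after a service completion in the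
non-alternating system with service time law `μA` and preparation time law `μB`. -/
structure IsStationaryNonAlt (μA μB ρ : Measure ℝ) : Prop where
  isProbabilityMeasure : IsProbabilityMeasure ρ
  invariant : (ρ.prod (μA.prod μB)).map (fun p => nonAltStep p.1 p.2.1 p.2.2) = ρ

/-- The law of the waiting time `min {B, R}` in the non-alternating system, where `R ∼ ρ` and
`B ∼ μB` are independent. -/
def nonAltWaitLaw (μB ρ : Measure ℝ) : Measure ℝ :=
  (ρ.prod μB).map (fun p => nonAltWait p.1 p.2)

end

/-!
The comparison is a form of Kac's formula for the atom `0` of the alternating chain.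

Let `e n x` (`altAvoid` below) be the probability that the alternating system, started from the
waiting time `x`, has `n` further waiting times that are all positive. Conditioning on the first
step, `e (n + 1) x = 𝔼[1_{Y > 0} e n Y]` where `Y = max 0 (B - A - x)`. For a stationary
`W` of the alternating chain this gives `𝔼[e n W] = e n 0 * ℙ[W = 0] + 𝔼[e (n + 1) W]`, and summing,
`ℙ[W = 0] * ∑_{j < n} e j 0 + 𝔼[e n W] = 1`
(`lintegral_altAvoid_of_isStationaryAlt`).

The non-alternating step moves `r` to the same point as the alternating one whenever the latter is
positive, and it may also be positive when the alternating one is `0`. Hence for a stationary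
remaining preparation time `R` the same computation yields the inequality
`ℙ[R = 0] * ∑_{j < n} e j 0 + 𝔼[e n R] ≤ 1` (`lintegral_altAvoid_of_isStationaryNonAlt`).
Eliminating the sum gives `ℙ[R = 0] ≤ ℙ[W = 0] + sup e n`, and `sup e n` tends to `0` geometrically:
if `B - A` is not almost surely constant, alternating a large and a small value of
`B - A` decreases the waiting time by a fixed amount every two steps
(`exists_indicator_altAvoid_le_of_le_mul`), and a constant `B - A ≤ 0` makes every waiting time zero
after the first step (`exists_altAvoid_le`). Finally `min {B, R} = 0` means `R = 0`, since `B > 0`.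
-/

open Set
open scoped ENNReal

/-! ### Avoiding zero in the alternating system -/

/-- `altAvoid ν n x` is the probability that, in the alternating system started from the waiting
time `x` and driven by independent pairs (service time, preparation time) of law `ν`, the next `n`
waiting times are all positive. The initial value `x` itself is unconstrained. -/
noncomputable def altAvoid (ν : Measure (ℝ × ℝ)) : ℕ → ℝ → ℝ≥0∞
  | 0, _ => 1
  | n + 1, x => ∫⁻ p, (Ioi (0 : ℝ)).indicator (altAvoid ν n) (altStep x p.1 p.2) ∂ν

section altAvoid

variable {ν : Measure (ℝ × ℝ)}

lemma measurable_altStep : Measurable fun q : ℝ × ℝ × ℝ => altStep q.1 q.2.1 q.2.2 := by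
  unfold altStep
  fun_prop

lemma measurable_nonAltStep : Measurable fun q : ℝ × ℝ × ℝ => nonAltStep q.1 q.2.1 q.2.2 := by
  unfold nonAltStep nonAltWait
  fun_prop

lemma measurable_altAvoid [SFinite ν] (n : ℕ) : Measurable (altAvoid ν n) := by
  induction n with
  | zero => exact measurable_const
  | succ n ih =>
    exact Measurable.lintegral_prod_right'
      (f := fun q : ℝ × ℝ × ℝ =>
        (Ioi (0 : ℝ)).indicator (altAvoid ν n) (altStep q.1 q.2.1 q.2.2))
      ((ih.indicator measurableSet_Ioi).comp measurable_altStep)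

lemma altAvoid_add_le [SFinite ν] {n : ℕ} {θ : ℝ≥0∞} (h : ∀ x, altAvoid ν n x ≤ θ) (m : ℕ)
    (x : ℝ) : altAvoid ν (n + m) x ≤ θ * altAvoid ν m x := by
  induction m generalizing x with
  | zero => simpa [altAvoid] using h x
  | succ m ih =>
    have hm : Measurable fun p : ℝ × ℝ =>
        (Ioi (0 : ℝ)).indicator (altAvoid ν m) (altStep x p.1 p.2) :=
      ((measurable_altAvoid m).indicator measurableSet_Ioi).comp
        (measurable_altStep.comp measurable_prodMk_left)
    calc altAvoid ν (n + (m + 1)) x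
        ≤ ∫⁻ p, θ * (Ioi (0 : ℝ)).indicator (altAvoid ν m) (altStep x p.1 p.2) ∂ν := by
          refine lintegral_mono fun p => ?_
          by_cases hp : altStep x p.1 p.2 ∈ Ioi (0 : ℝ)
          · rw [indicator_of_mem hp, indicator_of_mem hp]
            exact ih _
          · rw [indicator_of_notMem hp]
            exact zero_le
      _ = θ * altAvoid ν (m + 1) x := lintegral_const_mul _ hm

variable [IsProbabilityMeasure ν]

lemma altAvoid_le_one (n : ℕ) (x : ℝ) : altAvoid ν n x ≤ 1 := by
  induction n generalizing x with
  | zero => exact le_rfl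
  | succ n ih =>
    calc altAvoid ν (n + 1) x ≤ ∫⁻ _, 1 ∂ν :=
          lintegral_mono fun p => (indicator_le_self _ _ _).trans (ih _)
      _ = 1 := by simp

lemma altAvoid_succ_le (n : ℕ) (x : ℝ) : altAvoid ν (n + 1) x ≤ altAvoid ν n x := by
  induction n generalizing x with
  | zero => exact altAvoid_le_one 1 x
  | succ n ih => exact lintegral_mono fun p => indicator_le_indicator (ih _)

lemma antitone_altAvoid (x : ℝ) : Antitone fun n => altAvoid ν n x :=
  antitone_nat_of_succ_le fun n => altAvoid_succ_le n x

lemma altAvoid_mul_le_pow {n : ℕ} {θ : ℝ≥0∞} (h : ∀ x, altAvoid ν n x ≤ θ) (k : ℕ) (x : ℝ) :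
    altAvoid ν (n * k) x ≤ θ ^ k := by
  induction k generalizing x with
  | zero => simpa using altAvoid_le_one 0 x
  | succ k ih =>
    rw [Nat.mul_succ, add_comm, pow_succ']
    exact (altAvoid_add_le h _ x).trans (mul_le_mul_right (ih x) θ)

end altAvoid

/-! ### Geometric decay of the avoidance probability -/

/-- A function bounded by `1` that is at most `θ < 1` on a set of positive probability has mean
bounded away from `1`, uniformly over all such functions. -/
lemma exists_lintegral_le_of_le_on {Ω : Type*} [MeasurableSpace Ω] {ν : Measure Ω}
    [IsProbabilityMeasure ν] {s : Set Ω} (hs : MeasurableSet s) (hs0 : ν s ≠ 0) {θ : ℝ≥0∞}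
    (hθ : θ < 1) :
    ∃ θ' < 1, ∀ f : Ω → ℝ≥0∞, (∀ ω, f ω ≤ 1) → (∀ ω ∈ s, f ω ≤ θ) → ∫⁻ ω, f ω ∂ν ≤ θ' := by
  refine ⟨θ * ν s + ν sᶜ, ?_, fun f h1 hf => ?_⟩
  · calc θ * ν s + ν sᶜ < 1 * ν s + ν sᶜ :=
          ENNReal.add_lt_add_right (measure_ne_top _ _)
            (ENNReal.mul_lt_mul_left hs0 (measure_ne_top _ _) hθ)
      _ = 1 := by rw [one_mul, prob_add_prob_compl hs]
  · rw [← lintegral_add_compl f hs]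
    gcongr
    · exact (setLIntegral_mono measurable_const hf).trans (setLIntegral_const s θ).le
    · exact (setLIntegral_mono measurable_const fun ω _ => h1 ω).trans
        ((setLIntegral_const sᶜ 1).trans (one_mul _)).le

section decay

variable {ν : Measure (ℝ × ℝ)} [IsProbabilityMeasure ν]

/-- If `B - A` is at least `d` and then at most `c < d`, two steps of the alternating system decrease
the waiting time by at least `d - c`, or it reaches zero on the way. Iterating this `j` times bounds
the avoidance probability on `(0, j * (d - c)]`. -/
lemma exists_indicator_altAvoid_le_of_le_mul {c d : ℝ}
    (hc : ν {p | p.2 - p.1 ≤ c} ≠ 0) (hd : ν {p | d ≤ p.2 - p.1} ≠ 0) (j : ℕ) :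
    ∃ θ < 1, ∀ x ≤ j * (d - c), (Ioi (0 : ℝ)).indicator (altAvoid ν (2 * j)) x ≤ θ := by
  have hle : ∀ n x, (Ioi (0 : ℝ)).indicator (altAvoid ν n) x ≤ 1 := fun n x =>
    (indicator_le_self _ _ _).trans (altAvoid_le_one n x)
  induction j with
  | zero =>
    refine ⟨0, zero_lt_one, fun x hx => ?_⟩
    rw [indicator_of_notMem (by simpa using hx)]
  | succ j ih =>
    obtain ⟨θ, hθ, h⟩ := ih
    have hmc : MeasurableSet {p : ℝ × ℝ | p.2 - p.1 ≤ c} :=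
      measurableSet_le (by fun_prop) (by fun_prop)
    have hmd : MeasurableSet {p : ℝ × ℝ | d ≤ p.2 - p.1} :=
      measurableSet_le (by fun_prop) (by fun_prop)
    obtain ⟨θ₁, hθ₁, h₁⟩ := exists_lintegral_le_of_le_on hmc hc hθ
    obtain ⟨θ₂, hθ₂, h₂⟩ := exists_lintegral_le_of_le_on hmd hd hθ₁
    refine ⟨θ₂, hθ₂, fun x hx => (indicator_le_self _ _ _).trans ?_⟩
    refine h₂ _ (fun p => hle _ _) fun p hp => (indicator_le_self _ _ _).trans ?_
    refine h₁ _ (fun q => hle _ _) fun q hq => ?_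
    by_cases hpos : 0 < altStep (altStep x p.1 p.2) q.1 q.2
    · refine h _ ?_
      simp only [mem_ofPred_eq] at hp hq
      have h3 : p.2 - p.1 - x ≤ altStep x p.1 p.2 := le_max_right _ _
      have h4 : altStep (altStep x p.1 p.2) q.1 q.2 = q.2 - q.1 - altStep x p.1 p.2 :=
        max_eq_right (by
          by_contra! hlt
          exact hpos.ne' (max_eq_left hlt.le))
      push_cast at hx
      linarith
    · rw [indicator_of_notMem (by simpa using hpos)]
      exact zero_le

/-- If `B - A` takes both values at most `c` and values at least `d > c` with positive probability,
then the avoidance probability is eventually bounded away from `1`, uniformly in the initial value: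
from a waiting time above some `N` the alternating system jumps to zero with probability at least
`ℙ[B - A ≤ N] > 0`, and up to `N`, `exists_indicator_altAvoid_le_of_le_mul` applies. -/
lemma exists_altAvoid_le_of_lt {c d : ℝ} (hcd : c < d)
    (hc : ν {p | p.2 - p.1 ≤ c} ≠ 0) (hd : ν {p | d ≤ p.2 - p.1} ≠ 0) :
    ∃ n, ∃ θ < 1, ∀ x, altAvoid ν n x ≤ θ := by
  obtain ⟨N, hN⟩ : ∃ N : ℕ, ν {p | (N : ℝ) < p.2 - p.1} < 1 := by
    have hlim := tendsto_measure_iInter_atTop (μ := ν)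
      (s := fun N : ℕ => {p : ℝ × ℝ | (N : ℝ) < p.2 - p.1})
      (fun N => (measurableSet_lt (by fun_prop) (by fun_prop)).nullMeasurableSet)
      (fun m n hmn p (hp : (n : ℝ) < _) => lt_of_le_of_lt (Nat.cast_le.2 hmn) hp)
      ⟨0, measure_ne_top _ _⟩
    have hempty : ⋂ N : ℕ, {p : ℝ × ℝ | (N : ℝ) < p.2 - p.1} = ∅ := by
      refine eq_empty_of_forall_notMem fun p hp => ?_
      obtain ⟨N, hN⟩ := exists_nat_ge (p.2 - p.1)
      exact (mem_iInter.1 hp N).not_ge hN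
    rw [hempty, measure_empty] at hlim
    exact (hlim.eventually_lt_const zero_lt_one).exists
  obtain ⟨j, hj⟩ := exists_nat_ge (N / (d - c))
  rw [div_le_iff₀ (sub_pos.2 hcd)] at hj
  obtain ⟨θ, hθ, h⟩ := exists_indicator_altAvoid_le_of_le_mul hc hd j
  refine ⟨2 * j + 1 + 1, max θ (ν {p | (N : ℝ) < p.2 - p.1}), max_lt hθ hN, fun x => ?_⟩
  -- Whatever `x` is, the first step lands at `y`, which is either at most `N` or above it.
  have key : ∀ y, (Ioi (0 : ℝ)).indicator (altAvoid ν (2 * j + 1)) y ≤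
      max θ (ν {p | (N : ℝ) < p.2 - p.1}) := by
    intro y
    rcases le_total y N with hy | hy
    · exact (indicator_le_indicator (altAvoid_succ_le _ _)).trans
        ((h y (hy.trans hj)).trans (le_max_left _ _))
    · refine le_trans ?_ (le_max_right _ _)
      refine (indicator_le_self _ _ _).trans
        ((antitone_altAvoid y (Nat.le_add_left 1 (2 * j))).trans ?_)
      rw [← lintegral_indicator_one (measurableSet_lt (by fun_prop) (by fun_prop))]
      refine lintegral_mono fun p => ?_
      by_cases hp : (N : ℝ) < p.2 - p.1
      · rw [indicator_of_mem (show p ∈ {p : ℝ × ℝ | (N : ℝ) < p.2 - p.1} from hp)]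
        exact indicator_le_self _ _ _
      · have h0 : altStep y p.1 p.2 = 0 := max_eq_left (by linarith)
        simp [h0]
  calc altAvoid ν (2 * j + 1 + 1) x ≤ ∫⁻ _, max θ (ν {p | (N : ℝ) < p.2 - p.1}) ∂ν :=
        lintegral_mono fun p => key _
    _ = _ := by simp

/-- Uniform decay of the avoidance probability. When `B - A` is constant and not positive, the waiting
time is zero from the second step on, whatever its initial value. -/
lemma exists_altAvoid_le (hν : ∀ c : ℝ, 0 < c → ¬ ∀ᵐ p ∂ν, p.2 - p.1 = c) :
    ∃ n, ∃ θ < 1, ∀ x, altAvoid ν n x ≤ θ := by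
  by_cases hconst : ∃ c : ℝ, ∀ᵐ p ∂ν, p.2 - p.1 = c
  · obtain ⟨c, hc⟩ := hconst
    have hc0 : c ≤ 0 := not_lt.1 fun h => hν c h hc
    have h1 : ∀ y, (Ioi (0 : ℝ)).indicator (altAvoid ν 1) y = 0 := by
      intro y
      refine indicator_apply_eq_zero.2 fun hy => ?_
      refine (lintegral_congr_ae ?_).trans lintegral_zero
      filter_upwards [hc] with p hp
      have h0 : altStep y p.1 p.2 = 0 :=
        max_eq_left (by rw [hp]; linarith [mem_Ioi.1 hy])
      simp [h0]
    refine ⟨1 + 1, 0, zero_lt_one, fun x => ?_⟩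
    calc altAvoid ν (1 + 1) x = ∫⁻ _, 0 ∂ν := lintegral_congr fun p => h1 _
      _ ≤ 0 := lintegral_zero.le
  · -- Half-lines separate points, so some threshold `c` splits the law of `B - A`.
    obtain ⟨c, hc, hc'⟩ : ∃ c : ℝ, ν {p | p.2 - p.1 ≤ c} ≠ 0 ∧ ν {p | c < p.2 - p.1} ≠ 0 := by
      by_contra! hsplit
      refine hconst (Filter.exists_eventuallyEq_const_of_forall_separating
        (l := ae ν) (f := fun p : ℝ × ℝ => p.2 - p.1) (· ∈ range (Iic (α := ℝ))) ?_)
      rintro _ ⟨c, rfl⟩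
      by_cases hc : ν {p | p.2 - p.1 ≤ c} = 0
      · exact .inr (measure_eq_zero_iff_ae_notMem.1 hc)
      · refine .inl ?_
        filter_upwards [measure_eq_zero_iff_ae_notMem.1 (hsplit c hc)] with p hp
        exact not_lt.1 hp
    obtain ⟨k, hk⟩ : ∃ k : ℕ, ν {p | c + 1 / ((k : ℝ) + 1) ≤ p.2 - p.1} ≠ 0 := by
      by_contra! hall
      refine hc' (measure_mono_null (fun p (hp : c < p.2 - p.1) => ?_)
        (measure_iUnion_null hall))
      obtain ⟨k, hk⟩ := exists_nat_one_div_lt (sub_pos.2 hp)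
      exact mem_iUnion.2 ⟨k, show c + 1 / ((k : ℝ) + 1) ≤ p.2 - p.1 by linarith⟩
    exact exists_altAvoid_le_of_lt (lt_add_of_pos_right c Nat.one_div_pos_of_nat) hc hk

end decay

/-! ### Stationary laws -/

lemma nonneg_of_isStationaryAlt {μA μB π : Measure ℝ} (hπ : IsStationaryAlt μA μB π) :
    ∀ᵐ w ∂π, 0 ≤ w := by
  rw [← hπ.invariant]
  exact (ae_map_iff measurable_altStep.aemeasurable measurableSet_Ici).2
    (.of_forall fun _ => le_max_left _ _)

lemma nonneg_of_isStationaryNonAlt {μA μB ρ : Measure ℝ} (hρ : IsStationaryNonAlt μA μB ρ) :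
    ∀ᵐ r ∂ρ, 0 ≤ r := by
  rw [← hρ.invariant]
  exact (ae_map_iff measurable_nonAltStep.aemeasurable measurableSet_Ici).2
    (.of_forall fun _ => le_max_left _ _)

lemma lintegral_eq_mul_zero_add_indicator {π : Measure ℝ} (hπ : ∀ᵐ w ∂π, 0 ≤ w) (f : ℝ → ℝ≥0∞) :
    ∫⁻ w, f w ∂π = f 0 * π {0} + ∫⁻ w, (Ioi (0 : ℝ)).indicator f w ∂π := by
  rw [lintegral_indicator measurableSet_Ioi, ← lintegral_singleton f 0,
    ← lintegral_union measurableSet_Ioi (by simp), singleton_union, Ioi_insert,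
    Measure.restrict_eq_self_of_ae_mem (s := Ici 0) hπ]

lemma altStep_eq_nonAltStep {r a b : ℝ} (ha : 0 ≤ a) (h : 0 < altStep r a b) :
    altStep r a b = nonAltStep r a b := by
  have h' : 0 < b - a - r := (lt_max_iff.1 h).resolve_left (lt_irrefl _)
  have hb : r ≤ b := by linarith
  rw [altStep, nonAltStep, nonAltWait, max_eq_left hb, min_eq_right hb]
  congr 1
  ring

section stationary

variable {μA μB : Measure ℝ} [IsProbabilityMeasure μA] [IsProbabilityMeasure μB]

lemma lintegral_altAvoid_of_isStationaryAlt {π : Measure ℝ} (hπ : IsStationaryAlt μA μB π)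
    (n : ℕ) :
    π {0} * ∑ j ∈ Finset.range n, altAvoid (μA.prod μB) j 0 +
      ∫⁻ w, altAvoid (μA.prod μB) n w ∂π = 1 := by
  have := hπ.isProbabilityMeasure
  induction n with
  | zero => simp [altAvoid]
  | succ n ih =>
    have hm := measurable_altAvoid (ν := μA.prod μB) n
    have hstep : ∫⁻ w, (Ioi (0 : ℝ)).indicator (altAvoid (μA.prod μB) n) w ∂π =
        ∫⁻ w, altAvoid (μA.prod μB) (n + 1) w ∂π := by
      conv_lhs => rw [← hπ.invariant]
      rw [lintegral_map (hm.indicator measurableSet_Ioi) measurable_altStep,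
        lintegral_prod (fun q : ℝ × ℝ × ℝ =>
          (Ioi (0 : ℝ)).indicator (altAvoid (μA.prod μB) n) (altStep q.1 q.2.1 q.2.2))
        ((hm.indicator measurableSet_Ioi).comp measurable_altStep).aemeasurable]
      rfl
    rw [lintegral_eq_mul_zero_add_indicator (nonneg_of_isStationaryAlt hπ), hstep] at ih
    rw [Finset.sum_range_succ, ← ih]
    ring

lemma lintegral_altAvoid_of_isStationaryNonAlt (hA : ∀ᵐ a ∂μA, 0 ≤ a) {ρ : Measure ℝ}
    (hρ : IsStationaryNonAlt μA μB ρ) (n : ℕ) :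
    ρ {0} * ∑ j ∈ Finset.range n, altAvoid (μA.prod μB) j 0 +
      ∫⁻ r, altAvoid (μA.prod μB) n r ∂ρ ≤ 1 := by
  have := hρ.isProbabilityMeasure
  induction n with
  | zero => simp [altAvoid]
  | succ n ih =>
    have hm := measurable_altAvoid (ν := μA.prod μB) n
    have hstep : ∫⁻ r, altAvoid (μA.prod μB) (n + 1) r ∂ρ ≤
        ∫⁻ r, (Ioi (0 : ℝ)).indicator (altAvoid (μA.prod μB) n) r ∂ρ := by
      conv_rhs => rw [← hρ.invariant]
      rw [lintegral_map (hm.indicator measurableSet_Ioi) measurable_nonAltStep,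
        lintegral_prod (fun q : ℝ × ℝ × ℝ =>
          (Ioi (0 : ℝ)).indicator (altAvoid (μA.prod μB) n) (nonAltStep q.1 q.2.1 q.2.2))
        ((hm.indicator measurableSet_Ioi).comp measurable_nonAltStep).aemeasurable]
      refine lintegral_mono fun r => lintegral_mono_ae ?_
      filter_upwards [Measure.quasiMeasurePreserving_fst.ae hA] with p hp
      by_cases hpos : 0 < altStep r p.1 p.2
      · rw [altStep_eq_nonAltStep hp hpos]
      · rw [indicator_of_notMem (s := Ioi 0) hpos]
        exact zero_le
    rw [lintegral_eq_mul_zero_add_indicator (nonneg_of_isStationaryNonAlt hρ)] at ih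
    refine le_trans ?_ ih
    rw [Finset.sum_range_succ, mul_add, add_assoc, mul_comm (ρ {0}) (altAvoid _ n 0)]
    gcongr

lemma nonAltWaitLaw_singleton_zero_le (hB : ∀ᵐ b ∂μB, 0 < b) {ρ : Measure ℝ}
    [IsProbabilityMeasure ρ] : nonAltWaitLaw μB ρ {0} ≤ ρ {0} := by
  have hm : Measurable fun p : ℝ × ℝ => nonAltWait p.1 p.2 := by
    unfold nonAltWait
    fun_prop
  rw [nonAltWaitLaw, Measure.map_apply hm (measurableSet_singleton 0)]
  calc ρ.prod μB ((fun p : ℝ × ℝ => nonAltWait p.1 p.2) ⁻¹' {0})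
      ≤ ρ.prod μB ({0} ×ˢ univ) := by
        refine measure_mono_ae ?_
        filter_upwards [Measure.quasiMeasurePreserving_snd.ae hB] with p hp h0
        have h0' : min p.2 p.1 = 0 := h0
        rcases min_choice p.2 p.1 with h | h
        · exact absurd (h.symm.trans h0') hp.ne'
        · exact ⟨h.symm.trans h0', mem_univ _⟩
    _ = ρ {0} := by simp

end stationary

theorem mainTheorem5
    (μA μB : Measure ℝ) [IsProbabilityMeasure μA] [IsProbabilityMeasure μB]
    (hA : ∀ᵐ a ∂μA, 0 ≤ a) (hB : ∀ᵐ b ∂μB, 0 < b)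
    (hAB : ∀ c : ℝ, 0 < c → ¬ ∀ᵐ p ∂(μA.prod μB), p.2 - p.1 = c)
    (π ρ : Measure ℝ)
    (hπ : IsStationaryAlt μA μB π) (hρ : IsStationaryNonAlt μA μB ρ) :
    nonAltWaitLaw μB ρ {0} ≤ π {0} := by
  have := hπ.isProbabilityMeasure
  have := hρ.isProbabilityMeasure
  refine (nonAltWaitLaw_singleton_zero_le hB).trans ?_
  obtain ⟨n, θ, hθ, h⟩ := exists_altAvoid_le hAB
  have hbound : ∀ k : ℕ, ρ {0} ≤ π {0} + θ ^ k := by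
    intro k
    set S := ∑ j ∈ Finset.range (n * k), altAvoid (μA.prod μB) j 0
    have hW : π {0} * S + ∫⁻ w, altAvoid (μA.prod μB) (n * k) w ∂π = 1 :=
      lintegral_altAvoid_of_isStationaryAlt hπ (n * k)
    have hR : ρ {0} * S ≤ 1 :=
      le_self_add.trans (lintegral_altAvoid_of_isStationaryNonAlt hA hρ (n * k))
    have hdecay : ∫⁻ w, altAvoid (μA.prod μB) (n * k) w ∂π ≤ θ ^ k := by
      calc ∫⁻ w, altAvoid (μA.prod μB) (n * k) w ∂π ≤ ∫⁻ _, θ ^ k ∂π :=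
            lintegral_mono fun w => altAvoid_mul_le_pow h k w
        _ = θ ^ k := by simp
    calc ρ {0} = ρ {0} * (π {0} * S + ∫⁻ w, altAvoid (μA.prod μB) (n * k) w ∂π) := by
          rw [hW, mul_one]
      _ = π {0} * (ρ {0} * S) + ρ {0} * ∫⁻ w, altAvoid (μA.prod μB) (n * k) w ∂π := by ring
      _ ≤ π {0} * 1 + 1 * θ ^ k := by
          gcongr
          exact prob_le_one
      _ = π {0} + θ ^ k := by rw [mul_one, one_mul]
  have hlim : Filter.Tendsto (fun k : ℕ => π {0} + θ ^ k) Filter.atTop (nhds (π {0} + 0)) :=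
    tendsto_const_nhds.add (ENNReal.tendsto_pow_atTop_nhds_zero_of_lt_one hθ)
  rw [add_zero] at hlim
  exact ge_of_tendsto' hlim hbound
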